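/- Let $X$ be an infinite set of cardinality $\kappa=\aleph_\alpha$, let $X^X$ be the full transformation monoid of $X$ (all maps $X\to X$ under composition), let $S\subseteq X^X$ be the monoid of all permutations of $X$, and put $\lambda=\max\{|\alpha|,\aleph_0\}$. For a submonoid $G$ of $X^X$ let $[S,G]$ be the set of all submonoids $M$ of $X^X$ with $S\subseteq M\subseteq G$. A submonoid $G\neq X^X$ is called precomplete if for every $f\in X^X\setminus G$ the set $G\cup\{f\}$ generates $X^X$. Let $D$ be the intersection of all precomplete submonoids of $X^X$ that contain $S$, and let $A'$ be the monoid of all $f\in X^X$ for which there is a cardinal $\xi<\kappa$ such that $|f^{-1}[\{x\}]|\le\xi$ for all $x\in X$ outside a set of cardinality less than $\kappa$. (1) There are exactly $2^{2^\lambda}$ submonoids of $X^X$ that contain $S$. (2) If $\kappa$ is regular, then $|[S,G]|=2^{2^\lambda}$ for every precomplete submonoid $G$ of $X^X$ containing $S$, and moreover $|[S,D]|=2^{2^\lambda}$. (3) If $\kappa$ is singular, then $A'$ is a precomplete submonoid of $X^X$ containing $S$, and $|[S,G]|=2^{2^\lambda}$ for every precomplete submonoid $G\neq A'$ of $X^X$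 containing $S$. Furthermore, if $\lambda<\kappa$, then $|[S,A']|=|[S,D]|=2^{2^\lambda}$, and if $\lambda=\kappa$, then $|[S,A']|=|[S,D]|=2^{(\kappa^{<\kappa})}$, where $\kappa^{<\kappa}=\sup\{\kappa^\xi:\xi<\kappa\text{ a cardinal}\}$. -/

import Mathlib

universe u

open Cardinal

namespace PermMonoids

variable {X : Type u}

/-- The monoid of all permutations of `X`, as a submonoid of the full transformation monoid
`Function.End X` (all maps `X → X` under composition). -/
def permMonoid (X : Type u) : Submonoid (Function.End X) where
  carrier := {f | Function.Bijective (f : X → X)}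
  one_mem' := Function.bijective_id
  mul_mem' := fun hf hg => Function.Bijective.comp hf hg

/-- A proper submonoid of the full transformation monoid is precomplete if together with any
map outside of it, it generates the full transformation monoid. -/
def IsPrecomplete (M : Submonoid (Function.End X)) : Prop :=
  M ≠ ⊤ ∧ ∀ f : Function.End X, f ∉ M →
    Submonoid.closure ((M : Set (Function.End X)) ∪ {f}) = ⊤

/-- The intersection of all precomplete submonoids that contain all permutations. -/
def precompleteInter (X : Type u) : Submonoid (Function.End X) :=
  sInf {G | permMonoid X ≤ G ∧ IsPrecomplete G}

/-- A subset of `X` is small if its cardinality is smaller than that of `X`. -/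
def IsSmallSet (s : Set X) : Prop := #s < #X

/-- A property holds for almost all elements of `X` if the set of exceptions is small. -/
def AlmostAll (p : X → Prop) : Prop := IsSmallSet {x | ¬ p x}

/-- The condition that there is `ξ < |X|` such that almost all fibres of `f` have cardinality
at most `ξ`. -/
def HasBoundedFibres (f : X → X) : Prop :=
  ∃ ξ : Cardinal.{u}, ξ < #X ∧ AlmostAll fun x => #(f ⁻¹' {x} : Set X) ≤ ξ

theorem hasBoundedFibres_id [Infinite X] : HasBoundedFibres (id : X → X) := by
  refine ⟨1, one_lt_aleph0.trans_le (aleph0_le_mk X), ?_⟩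
  have h : {x : X | ¬ #(id ⁻¹' {x} : Set X) ≤ 1} = ∅ := by
    ext x
    simp
  simp only [AlmostAll, IsSmallSet, h]
  rw [mk_eq_zero]
  exact aleph0_pos.trans_le (aleph0_le_mk X)

theorem HasBoundedFibres.comp [Infinite X] {f g : X → X}
    (hf : HasBoundedFibres f) (hg : HasBoundedFibres g) : HasBoundedFibres (f ∘ g) := by
  obtain ⟨ξ, hξ, hf⟩ := hf
  obtain ⟨η, hη, hg⟩ := hg
  refine ⟨ξ * η, mul_lt_of_lt (aleph0_le_mk X) hξ hη, ?_⟩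
  have hsub : {x : X | ¬ #((f ∘ g) ⁻¹' {x} : Set X) ≤ ξ * η} ⊆
      {x | ¬ #(f ⁻¹' {x} : Set X) ≤ ξ} ∪ f '' {x | ¬ #(g ⁻¹' {x} : Set X) ≤ η} := by
    intro x hx
    by_contra hcon
    simp only [Set.mem_union, not_or, Set.mem_ofPred_eq, not_not, Set.mem_image, not_exists,
      not_and] at hcon
    obtain ⟨h1, h2⟩ := hcon
    apply hx
    have hU : ((f ∘ g) ⁻¹' {x} : Set X) = ⋃ y : (f ⁻¹' {x} : Set X), g ⁻¹' {(y : X)} := by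
      ext z
      simp
    rw [hU]
    refine (mk_iUnion_le_sum_mk).trans ?_
    refine (sum_le_sum _ (fun _ => η) ?_).trans ?_
    · rintro ⟨y, hy⟩
      by_contra h
      exact h2 y h hy
    · rw [sum_const']
      gcongr
  have hsmall : #(f '' {x | ¬ #(g ⁻¹' {x} : Set X) ≤ η} : Set X) < #X :=
    lt_of_le_of_lt mk_image_le hg
  exact lt_of_le_of_lt ((mk_le_mk_of_subset hsub).trans (mk_union_le _ _))
    (add_lt_of_lt (aleph0_le_mk X) hf hsmall)

/-- The monoid of all maps `f` for which there is `ξ < |X|` such that almost all fibres of `f`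
have cardinality at most `ξ`. -/
def boundedFibreMonoid (X : Type u) [Infinite X] : Submonoid (Function.End X) where
  carrier := {f | HasBoundedFibres (f : X → X)}
  one_mem' := hasBoundedFibres_id
  mul_mem' := fun hf hg => HasBoundedFibres.comp hf hg

end PermMonoids

namespace PermMonoids

variable {X : Type u}

/-! Upper bounds: a map is determined, up to permutations on both sides, by how many fibres of each
size it has. At most `λ` cardinals are `≤ κ`, so there are at most `λ ^ λ = 2 ^ λ` such profiles,
and a monoid above `S` is a union of double cosets of `S`. For singular `κ`, a profile in `A'`
mentions fewer than `κ` sizes, which leaves at most `κ ^< κ` profiles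
(`mk_support_fibreProfile_lt`).

Lower bounds: take `λ` sizes `c i < κ`, each exceeding the sum of the earlier ones. For a set `B` of
indices, the spike map `f B` has one fibre of size `κ` and one of size `c i` for each `i ∈ B`. If `f
A = h ∘ f B ∘ π` then `A ⊆ B` (`exists_spike_maps`), so over an antichain of index sets, different
subfamilies generate different monoids with `S` (`two_power_le_mk_Icc`).

It remains to locate the spike maps. A precomplete `G ⊇ S` omitting one of them contains no map with
`κ` fibres of size `κ` (`not_hasManyLargeFibres_of_not_mem`). This is impossible for regular `κ` and
forces `G = A'` for singular `κ`. Spike maps with fewer than `κ` spikes have small range and lie in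
every such `G`; for singular `κ = λ` these suffice, and there is an antichain of at least `κ ^< κ`
of them. -/

/-! ### Extending injections to permutations; transversals. -/

theorem exists_perm_comp_eq {ι : Type*} {φ ψ : ι → X} (hφ : Function.Injective φ)
    (hψ : Function.Injective ψ)
    (h : #((Set.range φ)ᶜ : Set X) = #((Set.range ψ)ᶜ : Set X)) :
    ∃ π : Equiv.Perm X, ∀ i, π (φ i) = ψ i := by
  classical
  obtain ⟨e'⟩ := Cardinal.eq.1 h
  let e : Set.range φ ≃ Set.range ψ :=
    (Equiv.ofInjective φ hφ).symm.trans (Equiv.ofInjective ψ hψ)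
  refine ⟨(Equiv.Set.sumCompl _).symm.trans ((e.sumCongr e').trans (Equiv.Set.sumCompl _)), ?_⟩
  intro i
  have : φ i ∈ Set.range φ := ⟨i, rfl⟩
  simp only [Equiv.trans_apply, Equiv.Set.sumCompl_symm_apply_of_mem this,
    Equiv.sumCongr_apply, Sum.map_inl, Equiv.Set.sumCompl_apply_inl, e]
  have h2 : (Equiv.ofInjective φ hφ).symm ⟨φ i, this⟩ = i := by
    rw [Equiv.symm_apply_eq]; rfl
  rw [h2]; rfl

/-- Families of at most `#J` many sets of size at least `#J` have an injective transversal. -/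
theorem exists_injective_mem {J : Type u} (Y : J → Set X) (hY : ∀ j, #J ≤ #(Y j)) :
    ∃ y : J → X, Function.Injective y ∧ ∀ j, y j ∈ Y j := by
  classical
  obtain ⟨r, wo, hr⟩ := Cardinal.exists_ord_eq J
  have key : ∀ (j : J) (prev : (k : J) → r k j → X),
      ∃ x ∈ Y j, ∀ k (hk : r k j), prev k hk ≠ x := by
    intro j prev
    by_contra! hcon
    have h1 : Y j ⊆ Set.range (fun k : {k // r k j} => prev k.1 k.2) := by
      intro x hx
      obtain ⟨k, hk, h⟩ := hcon x hx
      exact ⟨⟨k, hk⟩, h⟩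
    have h2 : #{k // r k j} < #J := by
      have := Cardinal.card_typein_lt j hr
      rwa [Ordinal.card_typein] at this
    exact absurd ((hY j).trans ((mk_le_mk_of_subset h1).trans mk_range_le)) (not_le.2 h2)
  have hwf : WellFounded r := wo.wf
  let y : J → X := hwf.fix fun j prev => (key j prev).choose
  have hy : ∀ j, y j ∈ Y j ∧ ∀ k, r k j → y k ≠ y j := by
    intro j
    have e : y j = (key j fun k _ => y k).choose := hwf.fix_eq _ j
    rw [e]
    have := (key j fun k _ => y k).choose_spec
    exact this
  refine ⟨y, fun a b hab => ?_, fun j => (hy j).1⟩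
  rcases trichotomous_of r a b with h | h | h
  · exact absurd hab ((hy b).2 a h)
  · exact h
  · exact absurd hab.symm ((hy a).2 b h)

theorem mk_prod_bool [Infinite X] : #(X × Bool) = #X := by
  rw [mk_prod, mk_bool, lift_uzero, lift_ofNat]
  exact mul_eq_left (aleph0_le_mk X) (ofNat_le_aleph0.trans (aleph0_le_mk X)) (by simp)

theorem mk_eq_of_injective {f : X → X} {s : Set X} (hf : Function.Injective f)
    (h : ∀ x, f x ∈ s) : #s = #X :=
  (mk_set_le s).antisymm (mk_le_of_injective (f := fun x => (⟨f x, h x⟩ : s))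
    fun _ _ hab => hf (congrArg Subtype.val hab))

theorem perm_mem {G : Submonoid (Function.End X)} (hS : permMonoid X ≤ G) (π : Equiv.Perm X) :
    (π : X → X) ∈ G := hS π.bijective

theorem comp_mem {G : Submonoid (Function.End X)} {f g : X → X}
    (hf : f ∈ G) (hg : g ∈ G) : (f ∘ g : X → X) ∈ G := G.mul_mem hf hg

/-! ### Generating the full transformation monoid. -/

/-- The map has a full-sized set of values outside its image. -/
def IsCoLarge (f : X → X) : Prop := #((Set.range f)ᶜ : Set X) = #X

/-- Full-many fibres are full-sized. -/
def HasManyLargeFibres (f : X → X) : Prop := #{y | #(f ⁻¹' {y} : Set X) = #X} = #X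

/-- The map has a section whose image has full-sized complement. -/
def HasCoLargeSection (f : X → X) : Prop :=
  ∃ s : X → X, (∀ x, f (s x) = x) ∧ IsCoLarge s

theorem HasCoLargeSection.of_image {f : X → X} {Y : Set X} (hY : #(Yᶜ : Set X) = #X)
    (h : f '' Y = Set.univ) : HasCoLargeSection f := by
  have : ∀ x, ∃ y ∈ Y, f y = x := fun x => by
    have : x ∈ f '' Y := h ▸ Set.mem_univ x
    exact this
  choose s hsY hs using this
  refine ⟨s, hs, (mk_set_le _).antisymm (hY ▸ mk_le_mk_of_subset ?_)⟩
  rintro y hy ⟨x, rfl⟩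
  exact hy (hsY x)

theorem exists_injective_coLarge [Infinite X] :
    ∃ i : X → X, Function.Injective i ∧ IsCoLarge i := by
  obtain ⟨e⟩ := Cardinal.eq.1 (mk_prod_bool (X := X))
  refine ⟨fun x => e (x, false), fun a b h => by simpa using h, ?_⟩
  refine mk_eq_of_injective (f := fun x => e (x, true)) (fun a b h => by simpa using h) ?_
  rintro x ⟨y, hy⟩
  simp at hy

theorem exists_all_fibres_large [Infinite X] :
    ∃ p : X → X, ∀ y, #(p ⁻¹' {y} : Set X) = #X := by
  obtain ⟨e⟩ := Cardinal.eq.1 (show #X = #(X × X) by simp)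
  refine ⟨fun x => (e x).1, fun y => ?_⟩
  exact mk_eq_of_injective (f := fun x => e.symm (y, x)) (fun a b h => by simpa using h)
    (fun x => by simp)

theorem exists_fibres_le_two [Infinite X] :
    ∃ g : X → X, HasCoLargeSection g ∧ ∀ y, #(g ⁻¹' {y} : Set X) ≤ 2 := by
  obtain ⟨e⟩ := Cardinal.eq.1 (mk_prod_bool (X := X))
  refine ⟨fun x => (e.symm x).1, ⟨fun x => e (x, false), fun x => by simp, ?_⟩, fun y => ?_⟩
  · refine mk_eq_of_injective (f := fun x => e (x, true)) (fun a b h => by simpa using h) ?_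
    rintro x ⟨y, hy⟩
    simp at hy
  · have hsub : ((fun x => (e.symm x).1) ⁻¹' {y} : Set X) ⊆
        Set.range (fun b : ULift.{u} Bool => e (y, b.down)) := by
      intro x hx
      refine ⟨⟨(e.symm x).2⟩, ?_⟩
      simp only [Set.mem_preimage, Set.mem_singleton_iff] at hx
      simp [← hx]
    refine (mk_le_mk_of_subset hsub).trans (mk_range_le.trans ?_)
    simp

/-- Every fibre of `p` splits into two copies of `X`. Lifting `x` to the point labelled `x` in the
first copy over `h x` is injective and leaves all second copies free. -/
theorem section_of_all_fibres_large [Infinite X] {p : X → X}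
    (hp : ∀ y, #(p ⁻¹' {y} : Set X) = #X) (h : X → X) :
    ∃ i : X → X, Function.Injective i ∧ IsCoLarge i ∧ ∀ x, p (i x) = h x := by
  have : ∀ y, Nonempty (X × Bool ≃ (p ⁻¹' {y} : Set X)) := fun y =>
    Cardinal.eq.1 (mk_prod_bool.trans (hp y).symm)
  let e := fun y => (this y).some
  refine ⟨fun x => e (h x) (x, false), ?_, ?_, ?_⟩
  · intro a b hab
    have h1 : p (e (h a) (a, false)) = h a := (e (h a) (a, false)).2
    have h2 : p (e (h b) (b, false)) = h b := (e (h b) (b, false)).2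
    have h3 : h a = h b := by rw [← h1, ← h2]; exact congrArg p hab
    have h4 : (e (h a) (a, false) : X) = e (h a) (b, false) := by
      rw [show (e (h a) (a, false) : X) = e (h b) (b, false) from hab, h3]
    simpa using (e (h a)).injective (Subtype.ext h4)
  · obtain ⟨y⟩ := (inferInstance : Nonempty X)
    refine mk_eq_of_injective (f := fun x => (e y (x, true) : X)) (fun a b hab => ?_) ?_
    · simpa using (e y).injective (Subtype.ext hab)
    · rintro x ⟨z, hz⟩
      have hz : (e (h z) (z, false) : X) = e y (x, true) := hz
      have h1 : p (e (h z) (z, false)) = h z := (e (h z) (z, false)).2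
      have h2 : p (e y (x, true)) = y := (e y (x, true)).2
      have h3 : h z = y := by rw [← h1, ← h2, hz]
      rw [h3] at hz
      simpa using (e y).injective (Subtype.ext hz)
  · intro x
    exact (e (h x) (x, false)).2

theorem injective_coLarge_mem {G : Submonoid (Function.End X)} (hS : permMonoid X ≤ G)
    {i j : X → X} (hi : Function.Injective i) (hi' : IsCoLarge i) (hiG : i ∈ G)
    (hj : Function.Injective j) (hj' : IsCoLarge j) : j ∈ G := by
  obtain ⟨π, hπ⟩ := exists_perm_comp_eq hi hj (hi'.trans hj'.symm)
  have : j = π ∘ i := funext fun x => (hπ x).symm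
  rw [this]
  exact comp_mem (perm_mem hS π) hiG

/-- Every map factors as `p ∘ j` with `j` injective and co-large, and all such `j` arise from `i` by
a permutation on the left. -/
theorem eq_top_of_injective_of_all_fibres_large [Infinite X] {G : Submonoid (Function.End X)}
    (hS : permMonoid X ≤ G) {i p : X → X} (hi : Function.Injective i) (hi' : IsCoLarge i)
    (hiG : i ∈ G) (hp : ∀ y, #(p ⁻¹' {y} : Set X) = #X) (hpG : p ∈ G) : G = ⊤ := by
  refine eq_top_iff.2 fun h _ => ?_
  obtain ⟨j, hj, hj', hpj⟩ := section_of_all_fibres_large hp h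
  have : h = (p ∘ j : X → X) := funext fun x => (hpj x).symm
  rw [this]
  exact comp_mem hpG (injective_coLarge_mem hS hi hi' hiG hj hj')

theorem eq_top_of_coLargeSection [Infinite X] {G : Submonoid (Function.End X)}
    (hS : permMonoid X ≤ G) {i g q : X → X} (hi : Function.Injective i) (hi' : IsCoLarge i)
    (hiG : i ∈ G) (hg : HasCoLargeSection g) (hgG : g ∈ G)
    (hq : HasManyLargeFibres q) (hqG : q ∈ G) : G = ⊤ := by
  obtain ⟨s, hs, hs'⟩ := hg
  obtain ⟨e⟩ := Cardinal.eq.1 ((mk_prod_bool (X := X)).trans hq.symm)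
  have hφ : Function.Injective fun x : X => (e (x, false) : X) := fun a b hab => by
    simpa using e.injective (Subtype.ext hab)
  have hφ' : #((Set.range fun x : X => (e (x, false) : X))ᶜ : Set X) = #X := by
    refine mk_eq_of_injective (f := fun x : X => (e (x, true) : X)) (fun a b hab => ?_) ?_
    · simpa using e.injective (Subtype.ext hab)
    · rintro x ⟨z, hz⟩
      simpa using e.injective (Subtype.ext hz)
  -- `π` carries half of the values with full-sized fibres onto the image of the section of `g`, so
  -- that all fibres of `g ∘ π ∘ q` are full-sized.
  obtain ⟨π, hπ⟩ := exists_perm_comp_eq hφ (Function.LeftInverse.injective hs)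
    (hφ'.trans hs'.symm)
  refine eq_top_of_injective_of_all_fibres_large hS hi hi' hiG (p := g ∘ π ∘ q) (fun y => ?_)
    (comp_mem hgG (comp_mem (perm_mem hS π) hqG))
  refine (mk_set_le _).antisymm ?_
  have h1 : #(q ⁻¹' {(e (y, false) : X)} : Set X) = #X := (e (y, false)).2
  rw [← h1]
  refine mk_le_mk_of_subset fun x hx => ?_
  have hx : q x = e (y, false) := hx
  simp [hx, hπ, hs]

theorem mk_large_fibres_of_not_hasBoundedFibres {q : X → X} (hq : ¬ HasBoundedFibres q)
    {ξ : Cardinal.{u}} (hξ : ξ < #X) : #{y | ξ < #(q ⁻¹' {y} : Set X)} = #X := by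
  refine (mk_set_le _).antisymm (not_lt.1 fun h => hq ⟨ξ, hξ, ?_⟩)
  simpa [AlmostAll, IsSmallSet] using h

theorem hasBoundedFibres_of_forall_le [Infinite X] {f : X → X} {ξ : Cardinal.{u}} (hξ : ξ < #X)
    (h : ∀ y, #(f ⁻¹' {y} : Set X) ≤ ξ) : HasBoundedFibres f := by
  refine ⟨ξ, hξ, ?_⟩
  simp [AlmostAll, IsSmallSet, h, mk_ne_zero, pos_iff_ne_zero]

/-! ### Unbounded fibres on a set of singular cardinality. -/

/-- A singular cardinal is the supremum of fewer than itself many smaller cardinals. -/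
theorem exists_family_lt_of_isSingular (h : (#X).IsSingular) :
    ∃ (ι : Type u) (ξ : ι → Cardinal.{u}), #ι < #X ∧ Nonempty ι ∧ (∀ ν, ξ ν < #X) ∧
      ∀ c, (∀ ν, ξ ν ≤ c) → #X ≤ c := by
  obtain ⟨s, hs, hs'⟩ := Order.exists_cof_eq (α := (#X).ord.ToType)
  rw [Ordinal.cof_toType] at hs'
  have hsup : ∀ c, (∀ x : s, (Ordinal.ToType.toOrd x.1 : Ordinal.{u}).card ≤ c) → #X ≤ c := by
    intro c hc
    by_contra! hlt
    have hlt' : (Order.succ c).ord < (#X).ord := ord_lt_ord.2 (h.isSuccLimit.succ_lt hlt)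
    obtain ⟨x, hx, hle⟩ := hs (Ordinal.ToType.mk ⟨(Order.succ c).ord, hlt'⟩)
    have hle : (Order.succ c).ord ≤ (Ordinal.ToType.toOrd x : Ordinal.{u}) :=
      Subtype.coe_le_coe.2 (Ordinal.ToType.mk.le_symm_apply.2 hle)
    exact ((Order.succ_le_iff.1 (ord_le.1 hle)).trans_le (hc ⟨x, hx⟩)).false
  refine ⟨s, fun x => (Ordinal.ToType.toOrd x.1 : Ordinal.{u}).card, ?_, ?_, fun x => ?_, hsup⟩
  · rw [hs']; exact h.cof_ord_lt
  · by_contra hne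
    exact (hsup 0 fun x => (hne ⟨x⟩).elim).not_gt h.pos
  · exact lt_ord.1 (Ordinal.ToType.toOrd x.1).2

/-- Let `κ` be the supremum of `ξ ν`, with fewer than `κ` indices `ν`. For each of `κ` values `z`
whose fibre has more than `#ι` points, `π` moves into that fibre, for every `ν`, a value whose own
fibre exceeds `ξ ν`. The fibre of `q ∘ π ∘ q` over `z` then has size `κ`. -/
theorem exists_manyLargeFibres_of_not_hasBoundedFibres [Infinite X]
    (hX : (#X).IsSingular) {q : X → X} (hq : ¬ HasBoundedFibres q) :
    ∃ π : Equiv.Perm X, HasManyLargeFibres (q ∘ π ∘ q) := by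
  obtain ⟨ι, ξ, hι, ⟨ν₀⟩, hξ, hsup⟩ := exists_family_lt_of_isSingular hX
  -- The extra summand `X` here, and the factor `Bool` for `ζ` below, keep `κ` points unused on both
  -- sides, so that the partial injection extends to a permutation.
  have hJ : #((X × ι) ⊕ X) = #X := by
    rw [mk_sum, lift_id, lift_id, mk_prod, lift_id, lift_id,
      mul_eq_left (aleph0_le_mk X) hι.le (mk_ne_zero_iff.2 ⟨ν₀⟩), add_eq_self (aleph0_le_mk X)]
  obtain ⟨y, hy, hyY⟩ := exists_injective_mem (J := (X × ι) ⊕ X)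
    (Sum.elim (fun p => {y | ξ p.2 < #(q ⁻¹' {y} : Set X)}) fun _ => Set.univ) (by
      rw [hJ]
      rintro (p | x)
      · exact (mk_large_fibres_of_not_hasBoundedFibres hq (hξ p.2)).ge
      · simp)
  obtain ⟨ζ⟩ := Cardinal.eq.1 ((mk_prod_bool (X := X)).trans
    (mk_large_fibres_of_not_hasBoundedFibres hq hι).symm)
  have ht : ∀ z, Nonempty (ι ↪ (q ⁻¹' {(ζ z : X)} : Set X)) := fun z =>
    (Cardinal.le_def _ _).1 (ζ z).2.le
  let t := fun z => (ht z).some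
  have hqt : ∀ z ν, q (t z ν) = ζ z := fun z ν => (t z ν).2
  have hinj : ∀ z z' ν ν', (t z ν : X) = t z' ν' → z = z' ∧ ν = ν' := by
    intro z z' ν ν' h
    have h1 : z = z' := ζ.injective (Subtype.ext (by rw [← hqt z ν, ← hqt z' ν', h]))
    subst h1
    exact ⟨rfl, (t z).injective (Subtype.ext h)⟩
  obtain ⟨π, hπ⟩ := exists_perm_comp_eq (X := X) (ι := X × ι) (φ := fun p => y (Sum.inl p))
    (ψ := fun p => t (p.1, false) p.2) (fun a b h => by simpa using hy h)
    (fun a b h => by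
      have := hinj _ _ _ _ h
      exact Prod.ext (by simpa using this.1) this.2) (by
      trans #X
      · refine mk_eq_of_injective (f := fun x => y (Sum.inr x)) (fun a b h => by
          simpa using hy h) ?_
        rintro x ⟨p, hp⟩
        simpa using hy hp
      · refine (mk_eq_of_injective (f := fun x => (t (x, true) ν₀ : X)) (fun a b h => by
          simpa using (hinj _ _ _ _ h).1) ?_).symm
        rintro x ⟨p, hp⟩
        simpa using (hinj _ _ _ _ hp).1)
  refine ⟨π, mk_eq_of_injective (f := fun x => (ζ (x, false) : X)) (fun a b h => by
    simpa using ζ.injective (Subtype.ext h)) fun x => ?_⟩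
  refine (mk_set_le _).antisymm (hsup _ fun ν => ?_)
  refine (hyY (Sum.inl (x, ν))).le.trans (mk_le_mk_of_subset fun w hw => ?_)
  have hw : q w = y (Sum.inl (x, ν)) := hw
  simp [hw, hπ, hqt]

theorem not_hasBoundedFibres_of_hasManyLargeFibres {f : X → X} (hf : HasManyLargeFibres f) :
    ¬ HasBoundedFibres f := by
  rintro ⟨ξ, hξ, h⟩
  refine (lt_of_le_of_lt (mk_le_mk_of_subset ?_) h).ne hf
  intro y hy
  have hy : #(f ⁻¹' {y} : Set X) = #X := hy
  simpa [hy] using hξ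

theorem hasManyLargeFibres_of_all {p : X → X} (hp : ∀ y, #(p ⁻¹' {y} : Set X) = #X) :
    HasManyLargeFibres p := by
  simp [HasManyLargeFibres, hp]

theorem surjective_of_all_fibres_large [Infinite X] {p : X → X}
    (hp : ∀ y, #(p ⁻¹' {y} : Set X) = #X) : Function.Surjective p := by
  intro y
  have h : #(p ⁻¹' {y} : Set X) ≠ 0 := hp y ▸ mk_ne_zero X
  obtain ⟨⟨x, hx⟩⟩ := mk_ne_zero_iff.1 h
  exact ⟨x, hx⟩

/-! ### Maps contained in precomplete monoids. -/

/-- If `f` generates everything together with a submonoid `G`, then so does membership in a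
submonoid-closed predicate that holds on `G` and at `f`. -/
theorem IsPrecomplete.forall_of_closed {G : Submonoid (Function.End X)} (hG : IsPrecomplete G)
    {f : X → X} (hf : f ∉ G) {P : (X → X) → Prop} (hPG : ∀ g ∈ G, P g) (hPf : P f)
    (hmul : ∀ g h, P g → P h → P (g ∘ h)) (g : X → X) : P g := by
  have hmem : g ∈ Submonoid.closure ((G : Set (Function.End X)) ∪ {f}) :=
    (hG.2 f hf).symm ▸ Submonoid.mem_top (M := Function.End X) g
  refine Submonoid.closure_induction (M := Function.End X) (motive := fun x _ => P x) ?_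
    (hPG _ G.one_mem)
    (fun a b _ _ ha hb => hmul a b ha hb) hmem
  rintro x (hx | rfl)
  · exact hPG x hx
  · exact hPf

/-- Adding all maps of small range to `G` gives a composition-closed class. If `f ∉ G`, this class
is everything, so all maps of full-sized range are already in `G`; two of them generate everything
with `S`. -/
theorem mem_of_mk_range_lt [Infinite X] {G : Submonoid (Function.End X)}
    (hS : permMonoid X ≤ G) (hG : IsPrecomplete G) {f : X → X} (hf : #(Set.range f) < #X) :
    f ∈ G := by
  by_contra hfG
  have key := hG.forall_of_closed hfG (P := fun g => g ∈ G ∨ #(Set.range g) < #X)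
    (fun g hg => Or.inl hg) (Or.inr hf) (by
      rintro g h (hg | hg) (hh | hh)
      · exact Or.inl (comp_mem hg hh)
      · right
        rw [Set.range_comp]
        exact mk_image_le.trans_lt hh
      · exact Or.inr ((mk_le_mk_of_subset (Set.range_comp_subset_range h g)).trans_lt hg)
      · exact Or.inr ((mk_le_mk_of_subset (Set.range_comp_subset_range h g)).trans_lt hg))
  obtain ⟨i, hi, hi'⟩ := exists_injective_coLarge (X := X)
  obtain ⟨p, hp⟩ := exists_all_fibres_large (X := X)
  have hiG : i ∈ G := (key i).resolve_right (by rw [mk_range_eq i hi]; exact lt_irrefl _)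
  have hpG : p ∈ G := (key p).resolve_right (by
    rw [(surjective_of_all_fibres_large hp).range_eq, mk_univ]; exact lt_irrefl _)
  exact hG.1 (eq_top_of_injective_of_all_fibres_large hS hi hi' hiG hp hpG)

/-- Since `f` together with `G` generates everything, `G` must contain both an injective co-large
map and a map with a co-large section. A map in `G` with many large fibres would then make `G`
everything. -/
theorem not_hasManyLargeFibres_of_not_mem [Infinite X] {G : Submonoid (Function.End X)}
    (hS : permMonoid X ≤ G) (hG : IsPrecomplete G) {f : X → X} (hfG : f ∉ G)
    (hf : ∃ y, #(f ⁻¹' {y} : Set X) = #X) (hf' : IsCoLarge f) {q : X → X} (hq : q ∈ G) :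
    ¬ HasManyLargeFibres q := by
  intro hq'
  obtain ⟨i₀, hi₀, hi₀'⟩ := exists_injective_coLarge (X := X)
  obtain ⟨p, hp⟩ := exists_all_fibres_large (X := X)
  have h1 : ∃ i ∈ G, Function.Injective i ∧ IsCoLarge i := by
    by_contra! hno
    -- If `f ∘ g` is injective, the range of `g` meets a full-sized fibre of `f` in at most one
    -- point, so `g` is injective and co-large. If `G` has no such `g`, the predicate holds at `f`,
    -- but it fails at `i₀`.
    have key := hG.forall_of_closed hfG
      (P := fun w => w ∈ G ∨ ∀ g ∈ G, ¬ Function.Injective (w ∘ g : X → X))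
      (fun g hg => Or.inl hg) (by
        right
        intro g hg hinj
        obtain ⟨y, hy⟩ := hf
        refine hno g hg hinj.of_comp ?_
        have hsub : (f ⁻¹' {y} : Set X) ⊆ (Set.range g)ᶜ ∪ (Set.range g ∩ f ⁻¹' {y}) := by
          intro x hx
          by_cases h : x ∈ Set.range g
          · exact Or.inr ⟨h, hx⟩
          · exact Or.inl h
        have hone : #(Set.range g ∩ f ⁻¹' {y} : Set X) ≤ 1 := by
          rw [mk_le_one_iff_set_subsingleton]
          rintro _ ⟨⟨a, rfl⟩, ha⟩ _ ⟨⟨b, rfl⟩, hb⟩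
          have ha : f (g a) = y := ha
          have hb : f (g b) = y := hb
          exact congrArg g (hinj (ha.trans hb.symm))
        refine (mk_set_le _).antisymm (not_lt.1 fun hlt => ?_)
        have := ((mk_le_mk_of_subset hsub).trans (mk_union_le _ _)).trans_lt
          (add_lt_of_lt (aleph0_le_mk X) hlt
            (hone.trans_lt (one_lt_aleph0.trans_le (aleph0_le_mk X))))
        exact this.ne hy) (by
        rintro a b ha (hb | hb)
        · rcases ha with ha | ha
          · exact Or.inl (comp_mem ha hb)
          · exact Or.inr fun g hg hinj => ha _ (comp_mem hb hg) hinj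
        · exact Or.inr fun g hg hinj => hb g hg (Function.Injective.of_comp (f := a) hinj))
    rcases key i₀ with h | h
    · exact hno i₀ h hi₀ hi₀'
    · exact h _ G.one_mem hi₀
  have h2 : ∃ g ∈ G, HasCoLargeSection g := by
    by_contra! hno
    -- Dually, if `g ∘ f` is surjective, `g` already maps the range of `f` onto `X`, and so has a
    -- co-large section.
    have key := hG.forall_of_closed hfG
      (P := fun w => w ∈ G ∨ ∀ g ∈ G, ¬ Function.Surjective (g ∘ w : X → X))
      (fun g hg => Or.inl hg) (by
        right
        intro g hg hsurj
        refine hno g hg (.of_image (Y := Set.range f) hf' ?_)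
        exact (Set.range_comp (g : X → X) f).symm.trans hsurj.range_eq) (by
        rintro a b (ha | ha) hb
        · rcases hb with hb | hb
          · exact Or.inl (comp_mem ha hb)
          · exact Or.inr fun g hg hsurj => hb _ (comp_mem hg ha) hsurj
        · exact Or.inr fun g hg hsurj => ha g hg (Function.Surjective.of_comp (g := b) hsurj))
    obtain ⟨s, hs, hs', hps⟩ := section_of_all_fibres_large hp id
    rcases key p with h | h
    · exact hno p h ⟨s, hps, hs'⟩
    · exact h _ G.one_mem (surjective_of_all_fibres_large hp)
  obtain ⟨i, hiG, hi, hi'⟩ := h1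
  obtain ⟨g, hgG, hg⟩ := h2
  exact hG.1 (eq_top_of_coLargeSection hS hi hi' hiG hg hgG hq' hq)

/-- On a set of regular cardinality, maps with few full-sized fibres are closed under
composition. -/
theorem not_hasManyLargeFibres_comp [Infinite X] (hX : (#X).IsRegular) {f g : X → X}
    (hf : ¬ HasManyLargeFibres f) (hg : ¬ HasManyLargeFibres g) :
    ¬ HasManyLargeFibres (f ∘ g) := by
  intro h
  have hf : #{y | #(f ⁻¹' {y} : Set X) = #X} < #X := (mk_set_le _).lt_of_ne hf
  have hg : #{y | #(g ⁻¹' {y} : Set X) = #X} < #X := (mk_set_le _).lt_of_ne hg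
  have hsub : {y | #(f ∘ g ⁻¹' {y} : Set X) = #X} ⊆
      {y | #(f ⁻¹' {y} : Set X) = #X} ∪ f '' {y | #(g ⁻¹' {y} : Set X) = #X} := by
    intro y hy
    by_contra hcon
    simp only [Set.mem_union, Set.mem_ofPred_eq, Set.mem_image, not_or, not_exists,
      not_and] at hcon
    obtain ⟨h1, h2⟩ := hcon
    have hU : ((f ∘ g) ⁻¹' {y} : Set X) = ⋃ z : (f ⁻¹' {y} : Set X), g ⁻¹' {(z : X)} := by
      ext z
      simp
    -- Regularity enters here: a union of fewer than `κ` sets of size less than `κ` has size less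
    -- than `κ`.
    have hlt : #((f ∘ g) ⁻¹' {y} : Set X) < #X := by
      rw [hU, card_iUnion_lt_iff_forall_of_isRegular hX ((mk_set_le _).lt_of_ne h1)]
      rintro ⟨z, hz⟩
      exact (mk_set_le _).lt_of_ne fun h => h2 z h hz
    exact hlt.ne hy
  refine (lt_of_le_of_lt (mk_le_mk_of_subset hsub) ((mk_union_le _ _).trans_lt
    (add_lt_of_lt (aleph0_le_mk X) hf (mk_image_le.trans_lt hg)))).ne h

theorem mem_of_isRegular [Infinite X] (hX : (#X).IsRegular) {G : Submonoid (Function.End X)}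
    (hS : permMonoid X ≤ G) (hG : IsPrecomplete G) {f : X → X}
    (hf : ∃ y, #(f ⁻¹' {y} : Set X) = #X) (hf' : IsCoLarge f) (hfew : ¬ HasManyLargeFibres f) :
    f ∈ G := by
  by_contra hfG
  obtain ⟨p, hp⟩ := exists_all_fibres_large (X := X)
  exact hG.forall_of_closed hfG (P := fun g => ¬ HasManyLargeFibres g)
    (fun g hg => not_hasManyLargeFibres_of_not_mem hS hG hfG hf hf' hg) hfew
    (fun g h => not_hasManyLargeFibres_comp hX) p (hasManyLargeFibres_of_all hp)

theorem boundedFibreMonoid_ne_top [Infinite X] : boundedFibreMonoid X ≠ ⊤ := by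
  obtain ⟨p, hp⟩ := exists_all_fibres_large (X := X)
  intro h
  have : p ∈ boundedFibreMonoid X := h.symm ▸ Submonoid.mem_top (M := Function.End X) p
  exact not_hasBoundedFibres_of_hasManyLargeFibres (hasManyLargeFibres_of_all hp) this

/-- A map in `G` with unbounded fibres would yield one in `G` with many large fibres, so `G ≤ A'`. A
member of `A'` outside `G` would generate everything with `G`, yet stay inside the proper monoid
`A'`. -/
theorem eq_boundedFibreMonoid_of_not_mem [Infinite X] (hX : (#X).IsSingular)
    {G : Submonoid (Function.End X)} (hS : permMonoid X ≤ G) (hG : IsPrecomplete G) {f : X → X}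
    (hf : ∃ y, #(f ⁻¹' {y} : Set X) = #X) (hf' : IsCoLarge f) (hfG : f ∉ G) :
    G = boundedFibreMonoid X := by
  have hle : G ≤ boundedFibreMonoid X := by
    intro q hq
    by_contra hq'
    obtain ⟨π, hπ⟩ := exists_manyLargeFibres_of_not_hasBoundedFibres hX hq'
    exact not_hasManyLargeFibres_of_not_mem hS hG hfG hf hf'
      (comp_mem hq (comp_mem (perm_mem hS π) hq)) hπ
  refine hle.antisymm fun h hh => ?_
  by_contra hhG
  refine boundedFibreMonoid_ne_top (X := X) (eq_top_iff.2 ?_)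
  rw [← hG.2 h hhG, Submonoid.closure_le]
  rintro x (hx | rfl)
  · exact hle hx
  · exact hh

theorem injective_mem_boundedFibreMonoid [Infinite X] {f : X → X} (hf : Function.Injective f) :
    f ∈ boundedFibreMonoid X := by
  refine hasBoundedFibres_of_forall_le (one_lt_aleph0.trans_le (aleph0_le_mk X)) fun y => ?_
  rw [mk_le_one_iff_set_subsingleton]
  exact Set.subsingleton_singleton.preimage hf

theorem permMonoid_le_boundedFibreMonoid [Infinite X] :
    permMonoid X ≤ boundedFibreMonoid X :=
  fun _ hf => injective_mem_boundedFibreMonoid (Function.Bijective.injective hf)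

theorem isPrecomplete_boundedFibreMonoid [Infinite X] (hX : (#X).IsSingular) :
    IsPrecomplete (boundedFibreMonoid X) := by
  refine ⟨boundedFibreMonoid_ne_top, fun q hq => ?_⟩
  obtain ⟨i, hi, hi'⟩ := exists_injective_coLarge (X := X)
  obtain ⟨g, hg, hg'⟩ := exists_fibres_le_two (X := X)
  obtain ⟨π, hπ⟩ := exists_manyLargeFibres_of_not_hasBoundedFibres hX hq
  have hle : boundedFibreMonoid X ≤
      Submonoid.closure ((boundedFibreMonoid X : Set (Function.End X)) ∪ {q}) :=
    fun x hx => Submonoid.subset_closure (Or.inl hx)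
  have hqm : q ∈ Submonoid.closure ((boundedFibreMonoid X : Set (Function.End X)) ∪ {q}) :=
    Submonoid.subset_closure (Or.inr rfl)
  have hS := permMonoid_le_boundedFibreMonoid.trans hle
  refine eq_top_of_coLargeSection hS hi hi' (hle (injective_mem_boundedFibreMonoid hi)) hg
    (hle (hasBoundedFibres_of_forall_le ?_ hg')) hπ (comp_mem hqm (comp_mem (perm_mem hS π) hqm))
  exact ofNat_lt_aleph0.trans_le (aleph0_le_mk X)

/-! ### Upper bounds: counting fibre profiles. -/

/-- Two maps with the same number of fibres of each size lie in the same double coset of the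
permutations. -/
theorem exists_perm_conj_eq {f g : X → X}
    (h : ∀ c ≤ #X, #{y | #(f ⁻¹' {y} : Set X) = c} = #{y | #(g ⁻¹' {y} : Set X) = c}) :
    ∃ π σ : Equiv.Perm X, g = π ∘ f ∘ σ := by
  have h1 : ∀ c : Cardinal.{u}, Nonempty ({y // #(f ⁻¹' {y} : Set X) = c} ≃
      {y // #(g ⁻¹' {y} : Set X) = c}) := by
    intro c
    by_cases hc : c ≤ #X
    · exact Cardinal.eq.1 (h c hc)
    · have he : ∀ k : X → X, IsEmpty {y // #(k ⁻¹' {y} : Set X) = c} :=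
        fun k => ⟨fun y => hc (y.2 ▸ mk_set_le _)⟩
      have := he f
      have := he g
      exact ⟨Equiv.equivOfIsEmpty _ _⟩
  let ε := fun c => (h1 c).some
  -- `σ` matches values with fibres of equal size; `τ` below then matches the fibres themselves
  -- point by point.
  let σ : X ≃ X := (Equiv.sigmaFiberEquiv fun y => #(f ⁻¹' {y} : Set X)).symm.trans
    ((Equiv.sigmaCongrRight ε).trans (Equiv.sigmaFiberEquiv fun y => #(g ⁻¹' {y} : Set X)))
  have hσ : ∀ y, #(f ⁻¹' {y} : Set X) = #(g ⁻¹' {σ y} : Set X) := fun y =>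
    (ε _ ⟨y, rfl⟩).2.symm
  have h2 : ∀ y, Nonempty ({x // f x = y} ≃ {x // g x = σ y}) := fun y => Cardinal.eq.1 (hσ y)
  let δ := fun y => (h2 y).some
  let τ : X ≃ X := (Equiv.sigmaFiberEquiv f).symm.trans
    ((Equiv.sigmaCongr σ δ).trans (Equiv.sigmaFiberEquiv g))
  have hτ : ∀ x, g (τ x) = σ (f x) := fun x => (δ _ ⟨x, rfl⟩).2
  refine ⟨σ, τ.symm, funext fun x => ?_⟩
  simp [← hτ]

/-- A monoid containing the permutations is a union of their double cosets, so it is recovered from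
the set of values that `F` takes on it. -/
theorem mk_Icc_le_of_invariant {β : Type u} (F : (X → X) → β)
    (hF : ∀ f g, F f = F g → ∃ π σ : Equiv.Perm X, g = π ∘ f ∘ σ)
    (G : Submonoid (Function.End X)) (T : Set β) (hT : ∀ f ∈ G, F f ∈ T) :
    #(Set.Icc (permMonoid X) G) ≤ 2 ^ #T := by
  rw [← mk_set]
  have key : ∀ M N : Set.Icc (permMonoid X) G,
      {t : T | ∃ f ∈ M.1, F f = t} = {t : T | ∃ f ∈ N.1, F f = t} → M.1 ≤ N.1 := by
    intro M N h f hf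
    have : (⟨F f, hT f (M.2.2 hf)⟩ : T) ∈ {t : T | ∃ f ∈ N.1, F f = t} := h ▸ ⟨f, hf, rfl⟩
    obtain ⟨g, hg, hgf⟩ := this
    obtain ⟨π, σ, rfl⟩ := hF _ _ hgf
    exact comp_mem (perm_mem N.2.1 π) (comp_mem hg (perm_mem N.2.1 σ))
  refine mk_le_of_injective (f := fun M : Set.Icc (permMonoid X) G =>
    {t : T | ∃ f ∈ M.1, F f = t}) fun M N h => Subtype.ext ((key M N h).antisymm (key N M h.symm))

/-- Each value is a natural number or some `aleph γ` with `γ ≤ β`. -/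
theorem mk_le_of_forall_le_aleph {K : Type u} {v : K → Cardinal.{u}} (hv : Function.Injective v)
    {β : Ordinal.{u}} (h : ∀ k, v k ≤ aleph β) : #K ≤ max β.card ℵ₀ := by
  let Φ : ULift.{u} ℕ ⊕ (β + 1).ToType → Cardinal.{u} :=
    Sum.elim (fun n => (n.down : Cardinal.{u}))
      fun x => aleph (Ordinal.ToType.toOrd x : Ordinal.{u})
  have hΦ : ∀ k, ∃ s, Φ s = v k := by
    intro k
    rcases lt_or_ge (v k) ℵ₀ with hk | hk
    · obtain ⟨n, hn⟩ := lt_aleph0.1 hk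
      exact ⟨Sum.inl ⟨n⟩, hn.symm⟩
    · obtain ⟨γ, hγ⟩ := mem_range_aleph_iff.2 hk
      have hγβ : γ < β + 1 := Order.lt_add_one_iff.2 (aleph_le_aleph.1 (hγ ▸ h k))
      exact ⟨Sum.inr (Ordinal.ToType.mk ⟨γ, hγβ⟩), by simp [Φ, Ordinal.ToType.toOrd, hγ]⟩
  choose s hs using hΦ
  have hinj : Function.Injective s := fun a b hab => hv (by rw [← hs a, ← hs b, hab])
  refine (mk_le_of_injective hinj).trans ?_
  have h0 : ℵ₀ ≤ max β.card ℵ₀ := le_max_right _ _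
  simp only [mk_sum, mk_uLift, mk_nat, lift_aleph0, mk_toType, lift_id, Ordinal.card_add_one]
  exact add_le_of_le h0 h0 (add_le_of_le h0 (le_max_left _ _) (one_le_aleph0.trans h0))

theorem exists_enum_sizes (X : Type u) :
    ∃ d : X → Cardinal.{u}, (∀ x, d x < #X) ∧ ∀ c < #X, ∃ x, d x = c := by
  obtain ⟨e⟩ := Cardinal.eq.1 (mk_ord_toType #X)
  refine ⟨fun x => (Ordinal.ToType.toOrd (e.symm x) : Ordinal.{u}).card, fun x => ?_,
    fun c hc => ⟨e (Ordinal.ToType.mk ⟨c.ord, ord_lt_ord.2 hc⟩), ?_⟩⟩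
  · exact lt_ord.1 (Ordinal.ToType.toOrd (e.symm x)).2
  · simp [Ordinal.ToType.toOrd]

theorem le_powerlt_self [Infinite X] : #X ≤ #X ^< #X := by
  simpa using le_powerlt #X (one_lt_aleph0.trans_le (aleph0_le_mk X))

/-- A small set is the range of a map defined on some cardinal `d x < κ`. This gives at most `κ`
terms, each at most `κ ^< κ`. -/
theorem mk_small_sets_le [Infinite X] {Y : Type u} (hY : #Y ≤ #X) :
    #{s : Set Y // #s < #X} ≤ #X ^< #X := by
  obtain ⟨d, hd, hd'⟩ := exists_enum_sizes X
  have hsurj : Function.Surjective fun p : Σ x : X, ((d x).out → Y) =>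
      (⟨Set.range p.2, mk_range_le.trans_lt (by simpa using hd p.1)⟩ :
        {s : Set Y // #s < #X}) := by
    rintro ⟨s, hs⟩
    obtain ⟨x, hx⟩ := hd' _ hs
    obtain ⟨e⟩ := Cardinal.eq.1 ((mk_out (d x)).trans hx)
    exact ⟨⟨x, fun z => e z⟩, Subtype.ext (by
      change Set.range (Subtype.val ∘ e) = s
      rw [Set.range_comp, e.surjective.range_eq, Set.image_univ, Subtype.range_coe])⟩
  refine (mk_le_of_surjective hsurj).trans ?_
  rw [mk_sigma]
  refine (sum_le_sum _ (fun _ => #X ^< #X) fun x => ?_).trans ?_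
  · rw [← power_def, mk_out]
    exact (power_le_power_right hY).trans (le_powerlt _ (hd x))
  · rw [sum_const']
    exact mul_le_of_le ((aleph0_le_mk X).trans le_powerlt_self) le_powerlt_self le_rfl

/-- A type of codes for the cardinals up to the size of `X`. -/
abbrev SizeCode (X : Type u) : Type u := Shrink.{u} (Set.Iic #X)

namespace SizeCode

noncomputable def val (k : SizeCode X) : Cardinal.{u} := ((equivShrink (Set.Iic #X)).symm k).1

noncomputable def mk (s : Set X) : SizeCode X := equivShrink (Set.Iic #X) ⟨#s, mk_set_le s⟩

@[simp] theorem val_mk (s : Set X) : (mk s).val = #s := by simp [val, mk]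

theorem val_injective : Function.Injective (val (X := X)) := fun a b h => by
  simpa [val] using Subtype.ext h

theorem val_le (k : SizeCode X) : k.val ≤ #X := ((equivShrink (Set.Iic #X)).symm k).2

theorem exists_val_eq {c : Cardinal.{u}} (hc : c ≤ #X) : ∃ k : SizeCode X, k.val = c :=
  ⟨equivShrink (Set.Iic #X) ⟨c, hc⟩, by simp [val]⟩

theorem cardinal_le {α : Ordinal.{u}} (hX : #X = aleph α) :
    #(SizeCode X) ≤ max α.card ℵ₀ :=
  mk_le_of_forall_le_aleph val_injective fun k => hX ▸ k.val_le

end SizeCode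

/-- The number of fibres of each size. -/
noncomputable def fibreProfile (f : X → X) (k : SizeCode X) : SizeCode X :=
  SizeCode.mk {y | #(f ⁻¹' {y} : Set X) = k.val}

theorem exists_perm_conj_of_fibreProfile_eq {f g : X → X} (h : fibreProfile f = fibreProfile g) :
    ∃ π σ : Equiv.Perm X, g = π ∘ f ∘ σ := by
  refine exists_perm_conj_eq fun c hc => ?_
  obtain ⟨k, rfl⟩ := SizeCode.exists_val_eq hc
  simpa [fibreProfile] using congrArg SizeCode.val (congrFun h k)

theorem mk_Icc_le [Infinite X] {α : Ordinal.{u}} (hX : #X = aleph α)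
    (G : Submonoid (Function.End X)) :
    #(Set.Icc (permMonoid X) G) ≤ 2 ^ (2 : Cardinal.{u}) ^ (max α.card ℵ₀) := by
  refine (mk_Icc_le_of_invariant fibreProfile (fun _ _ => exists_perm_conj_of_fibreProfile_eq)
    G Set.univ fun _ _ => trivial).trans (power_le_power_left two_ne_zero ?_)
  have h0 : ℵ₀ ≤ max α.card ℵ₀ := le_max_right _ _
  rw [mk_univ, ← power_def]
  have hle := SizeCode.cardinal_le hX
  calc #(SizeCode X) ^ #(SizeCode X) ≤ (max α.card ℵ₀) ^ #(SizeCode X) := power_le_power_right hle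
    _ ≤ (max α.card ℵ₀) ^ (max α.card ℵ₀) :=
        power_le_power_left (aleph0_pos.trans_le h0).ne' hle
    _ = 2 ^ (max α.card ℵ₀) := power_self_eq h0

/-- `SizeCode.mk ∅` is the code of `0`. A size that occurs is either at most `ξ` or the size of one
of the fewer than `κ` exceptional fibres. -/
theorem mk_support_fibreProfile_lt [Infinite X] (hX : (#X).IsSingular) {f : X → X} (hf : HasBoundedFibres f) :
    #{k | fibreProfile f k ≠ SizeCode.mk ∅} < #X := by
  obtain ⟨ξ, hξ, h⟩ := hf
  have h0 : ℵ₀ < #X := (aleph0_le_mk X).lt_of_ne fun h =>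
    not_isSingular_aleph0 (h ▸ hX)
  have hsub : {k | fibreProfile f k ≠ SizeCode.mk ∅} ⊆
      {k | k.val ≤ max ξ ℵ₀} ∪
        (fun y => SizeCode.mk (f ⁻¹' {y})) '' {y | ¬ #(f ⁻¹' {y} : Set X) ≤ ξ} := by
    intro k hk
    by_cases hkξ : k.val ≤ ξ
    · exact Or.inl (hkξ.trans (le_max_left _ _))
    · right
      have : {y | #(f ⁻¹' {y} : Set X) = k.val} ≠ ∅ := fun h => hk (by rw [fibreProfile, h])
      obtain ⟨y, hy⟩ := Set.nonempty_iff_ne_empty.2 this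
      have hy : #(f ⁻¹' {y} : Set X) = k.val := hy
      exact ⟨y, by simpa [hy] using hkξ, SizeCode.val_injective (by simpa using hy)⟩
  refine (mk_le_mk_of_subset hsub).trans_lt ((mk_union_le _ _).trans_lt
    (add_lt_of_lt (aleph0_le_mk X) ?_ (mk_image_le.trans_lt h)))
  -- There are at most `max β.card ℵ₀ ≤ aleph β = max ξ ℵ₀` cardinals up to `aleph β`. This is below
  -- `κ` because a singular cardinal is uncountable.
  obtain ⟨β, hβ⟩ := mem_range_aleph_iff.2 (le_max_right ξ ℵ₀)
  have := mk_le_of_forall_le_aleph (K := {k : SizeCode X | k.val ≤ max ξ ℵ₀})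
    (v := fun k => k.1.val) (fun a b h => Subtype.ext (SizeCode.val_injective h))
    (β := β) (fun k => hβ.symm ▸ k.2)
  refine this.trans_lt ((max_le (Ordinal.card_le_aleph β) (aleph0_le_aleph β)).trans_lt ?_)
  rw [hβ]
  exact max_lt hξ h0

theorem mk_Icc_boundedFibreMonoid_le [Infinite X] {α : Ordinal.{u}} (hX : #X = aleph α)
    (hX' : (#X).IsSingular) :
    #(Set.Icc (permMonoid X) (boundedFibreMonoid X)) ≤ 2 ^ (#X ^< #X) := by
  refine (mk_Icc_le_of_invariant fibreProfile (fun _ _ => exists_perm_conj_of_fibreProfile_eq)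
    _ {m | #{k | m k ≠ SizeCode.mk ∅} < #X}
    fun f hf => mk_support_fibreProfile_lt hX' hf).trans (power_le_power_left two_ne_zero ?_)
  have hle : #(SizeCode X) ≤ #X :=
    (SizeCode.cardinal_le hX).trans (max_le (hX ▸ Ordinal.card_le_aleph α) (aleph0_le_mk X))
  have hle2 : #(SizeCode X × SizeCode X) ≤ #X := by
    rw [mk_prod, lift_id]
    exact mul_le_of_le (aleph0_le_mk X) hle hle
  -- A profile is encoded by its graph over its support, a small subset of a set of size at most
  -- `κ`.
  refine (mk_le_of_injective (f := fun m : {m : SizeCode X → SizeCode X |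
      #{k | m k ≠ SizeCode.mk ∅} < #X} =>
    (⟨(fun k => (k, m.1 k)) '' {k | m.1 k ≠ SizeCode.mk ∅}, mk_image_le.trans_lt m.2⟩ :
      {s : Set (SizeCode X × SizeCode X) // #s < #X})) ?_).trans (mk_small_sets_le hle2)
  have key : ∀ m n : SizeCode X → SizeCode X,
      (fun k => (k, m k)) '' {k | m k ≠ SizeCode.mk ∅} ⊆
        (fun k => (k, n k)) '' {k | n k ≠ SizeCode.mk ∅} →
      ∀ k, m k ≠ SizeCode.mk ∅ → m k = n k := by
    intro m n h k hk
    obtain ⟨l, -, hl⟩ := h ⟨k, hk, rfl⟩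
    obtain ⟨rfl, h2⟩ := Prod.ext_iff.1 hl
    exact h2.symm
  intro m n h
  have h := Subtype.ext_iff.1 h
  refine Subtype.ext (funext fun k => ?_)
  by_cases hk : m.1 k = SizeCode.mk ∅
  · by_cases hk' : n.1 k = SizeCode.mk ∅
    · rw [hk, hk']
    · exact (key n.1 m.1 h.ge k hk').symm
  · exact key m.1 n.1 h.le k hk

/-! ### Lower bounds: spike maps and antichains. -/

/-- For fast growing sizes `c i`, there are maps `f B` with one full-sized fibre and further
exactly one fibre of size `c i` for each `i ∈ B`, and factoring them through each other requires
inclusion of the index sets. -/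
theorem exists_spike_maps [Infinite X] {I : Type u} [LinearOrder I] (c : I → Cardinal.{u})
    (hI : #I ≤ #X) (hc : ∀ i, c i < #X)
    (hsum : ∀ i, Cardinal.sum (fun k : {k // k < i} => c k) < c i) :
    ∃ f : Set I → X → X, (∀ B, IsCoLarge (f B)) ∧ (∀ B, ∃ y, #(f B ⁻¹' {y} : Set X) = #X) ∧
      (∀ B, ¬ HasManyLargeFibres (f B)) ∧ (∀ B, #(Set.range (f B)) ≤ #B + 1) ∧
      ∀ A B (h : X → X) (π : Equiv.Perm X), f A = h ∘ f B ∘ π → A ⊆ B := by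
  classical
  -- The domain consists of a copy of `X`, always inside the large fibre, and a block of `c i`
  -- points for each `i`. Blocks with `i ∉ B` are sent by `r` into the large fibre too. In the
  -- codomain, a further copy of `X` is never hit.
  have hE : #X = #(X ⊕ Σ i, (c i).out) := by
    rw [mk_sum, lift_id, lift_id, mk_sigma]
    simp only [mk_out]
    refine (add_eq_left (aleph0_le_mk X)
      ((sum_le_sum _ (fun _ => #X) fun i => (hc i).le).trans ?_)).symm
    rw [sum_const']
    exact mul_le_of_le (aleph0_le_mk X) hI le_rfl
  obtain ⟨e⟩ := Cardinal.eq.1 hE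
  have hJ : #(Option I ⊕ X) = #X := by
    rw [mk_sum, lift_id, lift_id, mk_option]
    exact add_eq_right (aleph0_le_mk X)
      (add_le_of_le (aleph0_le_mk X) hI (one_le_aleph0.trans (aleph0_le_mk X)))
  obtain ⟨j⟩ := Cardinal.eq.1 hJ
  let r : Set I → X ⊕ (Σ i, (c i).out) → Option I := fun B =>
    Sum.elim (fun _ => none) fun p => if p.1 ∈ B then some p.1 else none
  let f : Set I → X → X := fun B x => j (Sum.inl (r B (e x)))
  have hsome : ∀ B x i, r B (e x) = some i → i ∈ B ∧ ∃ a : (c i).out, e x = Sum.inr ⟨i, a⟩ := by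
    intro B x i h
    rcases hx : e x with z | ⟨k, a⟩
    · simp [r, hx] at h
    · by_cases hk : k ∈ B
      · simp only [r, hx, Sum.elim_inr, hk, if_true, Option.some.injEq] at h
        subst h
        exact ⟨hk, a, rfl⟩
      · simp [r, hx, hk] at h
  have hfib : ∀ B i, #(f B ⁻¹' {j (Sum.inl (some i))} : Set X) ≤ c i := by
    intro B i
    have hsub : (f B ⁻¹' {j (Sum.inl (some i))} : Set X) ⊆
        Set.range fun a : (c i).out => e.symm (Sum.inr ⟨i, a⟩) := by
      intro x hx
      have hx : r B (e x) = some i := by simpa [f] using hx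
      obtain ⟨-, a, ha⟩ := hsome B x i hx
      exact ⟨a, by simp [← ha]⟩
    exact (mk_le_mk_of_subset hsub).trans (mk_range_le.trans_eq (mk_out _))
  have hnone : ∀ B, #(f B ⁻¹' {j (Sum.inl none)} : Set X) = #X := fun B =>
    mk_eq_of_injective (f := fun x => e.symm (Sum.inl x)) (fun a b h => by simpa using h)
      fun x => by simp [f, r]
  have hempty : ∀ B x, #(f B ⁻¹' {j (Sum.inr x)} : Set X) = 0 := by
    intro B x
    rw [mk_set_eq_zero_iff, Set.preimage_singleton_eq_empty]
    rintro ⟨y, hy⟩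
    simp [f] at hy
  refine ⟨f, fun B => ?_, fun B => ⟨_, hnone B⟩, fun B => ?_, fun B => ?_, ?_⟩
  · refine mk_eq_of_injective (f := fun x => j (Sum.inr x)) (fun a b h => by simpa using h) ?_
    rintro x ⟨y, hy⟩
    simp [f] at hy
  · intro h
    have hsub : {y | #(f B ⁻¹' {y} : Set X) = #X} ⊆ {j (Sum.inl none)} := by
      intro y hy
      have hy : #(f B ⁻¹' {y} : Set X) = #X := hy
      obtain ⟨z, rfl⟩ := j.surjective y
      rcases z with (_ | i) | x
      · rfl
      · exact absurd hy ((hfib B i).trans_lt (hc i)).ne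
      · rw [hempty] at hy
        exact absurd hy.symm (mk_ne_zero X)
    have := mk_le_mk_of_subset hsub
    rw [mk_singleton] at this
    exact (this.trans_lt (one_lt_aleph0.trans_le (aleph0_le_mk X))).ne h
  · have hsub : Set.range (f B) ⊆
        Set.range fun o : Option B => j (Sum.inl (o.map Subtype.val)) := by
      rintro _ ⟨x, rfl⟩
      rcases ho : r B (e x) with _ | i
      · exact ⟨none, by simp [f, ho]⟩
      · exact ⟨some ⟨i, (hsome B x i ho).1⟩, by simp [f, ho]⟩
    exact (mk_le_mk_of_subset hsub).trans (mk_range_le.trans_eq mk_option)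
  · intro A B h π hfac i hi
    by_contra hiB
    have hval : ∀ x, f A x = h (f B (π x)) := fun x => congrFun hfac x
    have hpos : ∀ a : (c i).out, f A (e.symm (Sum.inr ⟨i, a⟩)) = j (Sum.inl (some i)) := by
      intro a
      simp [f, r, hi]
    -- The fibre of `f A` over `i` is, up to `π`, a union of fibres of `f B`. Each has size at most
    -- `c i`, which excludes the large fibre and blocks `k > i`, while `k = i` is excluded by `i ∉
    -- B`. So `c i` points inject into the blocks below `i`, against `hsum`.
    have hmap : ∀ a : (c i).out, ∃ p : Σ k : {k // k < i}, (c k).out,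
        e (π (e.symm (Sum.inr ⟨i, a⟩))) = Sum.inr ⟨p.1, p.2⟩ := by
      intro a
      have hha := hpos a
      rw [hval] at hha
      set w := π (e.symm (Sum.inr ⟨i, a⟩))
      have hsub : (f B ⁻¹' {f B w} : Set X) ⊆ π '' (f A ⁻¹' {j (Sum.inl (some i))}) := by
        intro v hv
        have hv : f B v = f B w := hv
        refine ⟨π.symm v, ?_, by simp⟩
        simp [hval, hv, hha]
      have hle : #(f B ⁻¹' {f B w} : Set X) ≤ c i :=
        (mk_le_mk_of_subset hsub).trans (mk_image_le.trans (hfib A i))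
      rcases ho : r B (e w) with _ | k
      · have : f B w = j (Sum.inl none) := by simp [f, ho]
        rw [this, hnone] at hle
        exact absurd hle (not_le.2 (hc i))
      · obtain ⟨hkB, b, hb⟩ := hsome B w k ho
        have hki : k ≠ i := fun h => hiB (h ▸ hkB)
        have hlt : k < i := by
          refine lt_of_le_of_ne (not_lt.1 fun hik => ?_) hki
          have h1 : c k ≤ #(f B ⁻¹' {f B w} : Set X) := by
            rw [← mk_out (c k)]
            refine mk_le_of_injective (f := fun b' : (c k).out =>
              (⟨e.symm (Sum.inr ⟨k, b'⟩), by simp [f, ho, r, hkB]⟩ :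
                (f B ⁻¹' {f B w} : Set X))) fun a b hab => ?_
            simpa using hab
          have h2 : c i < c k :=
            (le_sum (fun l : {l // l < k} => c l) ⟨i, hik⟩).trans_lt (hsum k)
          exact (h2.trans_le (h1.trans hle)).false
        exact ⟨⟨⟨k, hlt⟩, b⟩, hb⟩
    choose p hp using hmap
    have hinj : Function.Injective p := by
      intro a b hab
      have : e (π (e.symm (Sum.inr ⟨i, a⟩))) = e (π (e.symm (Sum.inr ⟨i, b⟩))) := by
        rw [hp, hp, hab]
      simpa using this
    have := mk_le_of_injective hinj
    rw [mk_sigma] at this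
    simp only [mk_out] at this
    exact (this.trans_lt (hsum i)).false

theorem two_power_le_mk_Icc {T : Type u} {G : Submonoid (Function.End X)}
    (hS : permMonoid X ≤ G) (φ : T → X → X) (hφ : ∀ t, φ t ∈ G)
    (hns : ∀ t, ¬ Function.Bijective (φ t))
    (hfac : ∀ s t (h : X → X) (π : Equiv.Perm X), φ s = h ∘ φ t ∘ π → s = t) :
    2 ^ #T ≤ #(Set.Icc (permMonoid X) G) := by
  rw [← mk_set]
  let M : Set T → Submonoid (Function.End X) := fun J =>
    Submonoid.closure ((permMonoid X : Set (Function.End X)) ∪ φ '' J)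
  have hSM : ∀ J, permMonoid X ≤ M J := fun J x hx => Submonoid.subset_closure (Or.inl hx)
  have hMG : ∀ J, M J ≤ G := by
    intro J
    refine Submonoid.closure_le.2 ?_
    rintro x (hx | ⟨t, -, rfl⟩)
    · exact hS hx
    · exact hφ t
  -- In a word of generators, the rightmost letter that is not a permutation is some `φ t`;
  -- everything to its left is absorbed into `h`, everything to its right into `π`.
  have hmem : ∀ J (x : X → X), x ∈ M J → Function.Bijective x ∨
      ∃ t ∈ J, ∃ (h : X → X) (π : Equiv.Perm X), x = h ∘ φ t ∘ π := by
    intro J x hx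
    refine Submonoid.closure_induction (M := Function.End X) (motive := fun x _ =>
      Function.Bijective (x : X → X) ∨
        ∃ t ∈ J, ∃ (h : X → X) (π : Equiv.Perm X), x = h ∘ φ t ∘ π) ?_
      (Or.inl Function.bijective_id) ?_ hx
    · rintro x (hx | ⟨t, ht, rfl⟩)
      · exact Or.inl hx
      · exact Or.inr ⟨t, ht, id, 1, rfl⟩
    · rintro a b - - ha (hb | ⟨t, ht, h, π, rfl⟩)
      · rcases ha with ha | ⟨t, ht, h, π, rfl⟩
        · exact Or.inl (ha.comp hb)
        · exact Or.inr ⟨t, ht, h, (Equiv.ofBijective b hb).trans π, rfl⟩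
      · exact Or.inr ⟨t, ht, a ∘ h, π, rfl⟩
  have key : ∀ J K, M J = M K → J ⊆ K := by
    intro J K hJK t ht
    have h1 : φ t ∈ M J := Submonoid.subset_closure (Or.inr ⟨t, ht, rfl⟩)
    rcases hmem K (φ t) (hJK ▸ h1) with h | ⟨s, hs, h, π, heq⟩
    · exact absurd h (hns t)
    · rwa [hfac t s h π heq]
  refine mk_le_of_injective (f := fun J : Set T =>
    (⟨M J, hSM J, hMG J⟩ : Set.Icc (permMonoid X) G)) fun J K h => ?_
  have h := congrArg Subtype.val h
  exact (key J K h).antisymm (key K J h.symm)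

theorem IsCoLarge.not_bijective [Infinite X] {f : X → X} (hf : IsCoLarge f) :
    ¬ Function.Bijective f := by
  intro h
  have : (Set.range f)ᶜ = ∅ := by rw [h.surjective.range_eq, Set.compl_univ]
  rw [IsCoLarge, this, mk_eq_zero] at hf
  exact mk_ne_zero X hf.symm

/-- In `I ⊕ I`, the set `s` on the left is paired with its complement on the right, so inclusion
works in both directions. -/
theorem exists_antichain {I : Type u} (hI : ℵ₀ ≤ #I) :
    ∃ a : Set I → Set I, ∀ s t, a s ⊆ a t → s = t := by
  obtain ⟨e⟩ := Cardinal.eq.1 (show #(I ⊕ I) = #I by simp [add_eq_self hI])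
  refine ⟨fun s => {i | Sum.elim (· ∈ s) (· ∉ s) (e.symm i)}, fun s t h => ?_⟩
  ext i
  constructor
  · intro hi
    simpa using @h (e (Sum.inl i)) (by simpa using hi)
  · intro hi
    by_contra his
    have := @h (e (Sum.inr i)) (by simpa using his)
    exact absurd hi (by simpa using this)

/-- Complements are not small, so graphs of functions are used instead: for functions on a common
domain, inclusion of graphs is equality. The extra point `Sum.inr t.1` forces the domains to agree.
-/
theorem exists_antichain_small [Infinite X] {I : Type u} (hI : #I = #X) :
    ∃ (T : Type u) (a : T → Set I), #X ^< #X ≤ #T ∧ (∀ t, #(a t) < #X) ∧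
      ∀ s t, a s ⊆ a t → s = t := by
  obtain ⟨d, hd, hd'⟩ := exists_enum_sizes X
  have hle : ∀ x, ∃ D : Set X, #D = d x := fun x => le_mk_iff_exists_set.1 (hd x).le
  choose D hD using hle
  obtain ⟨e⟩ := Cardinal.eq.1 (show #((X × X) ⊕ X) = #I by
    simp [hI])
  refine ⟨Σ x, (D x → X), fun t => e '' (insert (Sum.inr t.1)
    (Set.range fun y : D t.1 => Sum.inl ((y : X), t.2 y))), ?_, fun t => ?_, ?_⟩
  · refine powerlt_le.2 fun c hc => ?_
    obtain ⟨x, rfl⟩ := hd' c hc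
    rw [← hD, power_def]
    exact mk_le_of_injective (f := fun g => (⟨x, g⟩ : Σ x, (D x → X))) fun g h hgh => by simpa using hgh
  · refine mk_image_le.trans_lt (mk_insert_le.trans_lt (add_lt_of_lt (aleph0_le_mk X)
      (mk_range_le.trans_lt (hD t.1 ▸ hd t.1)) (one_lt_aleph0.trans_le (aleph0_le_mk X))))
  · rintro ⟨x, g⟩ ⟨y, h⟩ hsub
    rw [Set.image_subset_image_iff e.injective, Set.insert_subset_iff] at hsub
    obtain ⟨h1, h2⟩ := hsub
    obtain rfl : x = y := by simpa using h1
    congr 1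
    funext z
    have := h2 ⟨z, rfl⟩
    simp only [Set.mem_insert_iff, reduceCtorEq, Set.mem_range, Sum.inl.injEq, Prod.mk.injEq,
      false_or] at this
    obtain ⟨w, hw, hw'⟩ := this
    rw [← hw', Subtype.ext hw]

theorem exists_fast_growing {α : Ordinal.{u}} :
    ∃ (I : Type u) (_ : LinearOrder I) (c : I → Cardinal.{u}), #I = max α.card ℵ₀ ∧
      (∀ i, c i < aleph α) ∧ ∀ i, Cardinal.sum (fun k : {k // k < i} => c k) < c i := by
  rcases le_total ℵ₀ α.card with h | h
  · refine ⟨α.card.ord.ToType, inferInstance,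
      fun i => aleph ((Ordinal.ToType.toOrd i : Ordinal.{u}) + 1), ?_, fun i => ?_, fun i => ?_⟩
    · rw [mk_ord_toType, max_eq_left h]
    · rw [aleph_lt_aleph]
      exact ((isSuccLimit_ord h).add_one_lt (Ordinal.ToType.toOrd i).2).trans_le
        (ord_card_le α)
    · set β : Ordinal.{u} := (Ordinal.ToType.toOrd i : Ordinal.{u}) with hβ
      have hlt : ∀ k : {k // k < i}, (Ordinal.ToType.toOrd k.1 : Ordinal.{u}) < β := fun k =>
        Subtype.coe_lt_coe.2 (Ordinal.ToType.mk.symm.strictMono k.2)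
      have hcard : #{k // k < i} ≤ aleph β := by
        refine le_trans ?_ (Ordinal.card_le_aleph β)
        rw [← mk_toType β]
        refine mk_le_of_injective (f := fun k : {k // k < i} =>
          Ordinal.ToType.mk ⟨(Ordinal.ToType.toOrd k.1 : Ordinal.{u}), hlt k⟩) ?_
        intro k l hkl
        have := congrArg Subtype.val (Ordinal.ToType.mk.injective hkl)
        exact Subtype.ext (Ordinal.ToType.mk.symm.injective (Subtype.ext this))
      refine (sum_le_sum _ (fun _ => aleph β) fun k => ?_).trans_lt ?_
      · exact aleph_le_aleph.2 (Order.add_one_le_of_lt (hlt k))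
      · rw [sum_const']
        refine (mul_le_of_le (aleph0_le_aleph β) hcard le_rfl).trans_lt ?_
        exact aleph_lt_aleph.2 (lt_add_one β)
  -- For countable `α` the sizes are finite: the `n` earlier terms `(k + 1)!` are at most `n!` each,
  -- and `n * n! < (n + 1)!`.
  · refine ⟨ULift.{u} ℕ, inferInstance, fun n => ((n.down + 1).factorial : ℕ), ?_,
      fun n => natCast_lt_aleph0.trans_le (aleph0_le_aleph α), fun n => ?_⟩
    · simp [max_eq_right h]
    · have hcard : #{k : ULift.{u} ℕ // k < n} ≤ (n.down : ℕ) := by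
        refine (mk_le_of_injective (f := fun k : {k : ULift.{u} ℕ // k < n} =>
          (⟨⟨k.1.down, k.2⟩⟩ : ULift.{u} (Fin n.down))) ?_).trans_eq (by simp)
        intro k l hkl
        have := congrArg (fun x => x.down.val) hkl
        exact Subtype.ext (ULift.ext _ _ this)
      refine (sum_le_sum _ (fun _ => ((n.down.factorial : ℕ) : Cardinal.{u})) fun k => ?_).trans_lt ?_
      · exact Nat.cast_le.2 (Nat.factorial_le (Nat.succ_le_of_lt k.2))
      · rw [sum_const']
        refine (mul_le_mul_left hcard _).trans_lt ?_
        have : n.down * n.down.factorial < (n.down + 1).factorial := by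
          rw [Nat.factorial_succ]
          exact Nat.mul_lt_mul_of_pos_right (Nat.lt_succ_self _) (Nat.factorial_pos _)
        rw [← Nat.cast_mul]
        exact Nat.cast_lt.2 this

end PermMonoids

/-! ### Combining the bounds. -/

theorem theorem2 {X : Type u} [Infinite X] (α : Ordinal.{u}) (κ lam : Cardinal.{u})
    (hX : #X = κ) (hκ : κ = Cardinal.aleph α) (hlam : lam = max α.card ℵ₀) :
    #{M : Submonoid (Function.End X) // PermMonoids.permMonoid X ≤ M} = (2 : Cardinal.{u}) ^ ((2 : Cardinal.{u}) ^ lam) ∧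
    (κ.IsRegular →
      (∀ G : Submonoid (Function.End X), PermMonoids.permMonoid X ≤ G →
        PermMonoids.IsPrecomplete G →
        #(Set.Icc (PermMonoids.permMonoid X) G) = (2 : Cardinal.{u}) ^ ((2 : Cardinal.{u}) ^ lam)) ∧
      #(Set.Icc (PermMonoids.permMonoid X) (PermMonoids.precompleteInter X)) = (2 : Cardinal.{u}) ^ ((2 : Cardinal.{u}) ^ lam)) ∧
    (κ.IsSingular →
      (PermMonoids.permMonoid X ≤ PermMonoids.boundedFibreMonoid X ∧
        PermMonoids.IsPrecomplete (PermMonoids.boundedFibreMonoid X)) ∧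
      (∀ G : Submonoid (Function.End X), PermMonoids.permMonoid X ≤ G →
        PermMonoids.IsPrecomplete G → G ≠ PermMonoids.boundedFibreMonoid X →
        #(Set.Icc (PermMonoids.permMonoid X) G) = (2 : Cardinal.{u}) ^ ((2 : Cardinal.{u}) ^ lam)) ∧
      (lam < κ →
        #(Set.Icc (PermMonoids.permMonoid X) (PermMonoids.boundedFibreMonoid X)) =
          (2 : Cardinal.{u}) ^ ((2 : Cardinal.{u}) ^ lam) ∧
        #(Set.Icc (PermMonoids.permMonoid X) (PermMonoids.precompleteInter X)) =
          (2 : Cardinal.{u}) ^ ((2 : Cardinal.{u}) ^ lam)) ∧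
      (lam = κ →
        #(Set.Icc (PermMonoids.permMonoid X) (PermMonoids.boundedFibreMonoid X)) =
          (2 : Cardinal.{u}) ^ (κ ^< κ) ∧
        #(Set.Icc (PermMonoids.permMonoid X) (PermMonoids.precompleteInter X)) =
          (2 : Cardinal.{u}) ^ (κ ^< κ))) := by
  open PermMonoids in
  subst hX
  have hup : ∀ G : Submonoid (Function.End X),
      #(Set.Icc (permMonoid X) G) ≤ 2 ^ (2 : Cardinal.{u}) ^ lam := fun G =>
    hlam ▸ mk_Icc_le hκ G
  obtain ⟨I, _, c, hI, hc, hsum⟩ := exists_fast_growing (α := α)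
  rw [← hlam] at hI
  have hlamX : lam ≤ #X := by
    rw [hlam]
    exact max_le (hκ ▸ Ordinal.card_le_aleph α) (aleph0_le_mk X)
  obtain ⟨f, hf, hf1, hf2, hf3, hf4⟩ := exists_spike_maps (X := X) c (hI.trans_le hlamX)
    (fun i => hκ ▸ hc i) hsum
  have hIinf : ℵ₀ ≤ #I := hI ▸ hlam ▸ le_max_right _ _
  obtain ⟨a, ha⟩ := exists_antichain hIinf
  have hfull : ∀ G : Submonoid (Function.End X), permMonoid X ≤ G → (∀ B, f B ∈ G) →
      #(Set.Icc (permMonoid X) G) = 2 ^ (2 : Cardinal.{u}) ^ lam := by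
    intro G hS hG
    refine (hup G).antisymm ?_
    have := two_power_le_mk_Icc hS (fun s => f (a s)) (fun s => hG _)
      (fun s => (hf _).not_bijective) fun s t h π heq => ha s t (hf4 _ _ h π heq)
    rwa [mk_set, hI] at this
  have hSD : permMonoid X ≤ precompleteInter X := le_sInf fun G hG => hG.1
  have hD : ∀ g : Function.End X, (∀ G : Submonoid (Function.End X), permMonoid X ≤ G →
      IsPrecomplete G → g ∈ G) → g ∈ precompleteInter X := fun g hg =>
    (Submonoid.mem_sInf (M := Function.End X)).2 fun G hG => hg G hG.1 hG.2
  have hsmall : ∀ B : Set I, #B < #X → f B ∈ precompleteInter X := fun B hB =>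
    hD _ fun G hS hG => mem_of_mk_range_lt hS hG ((hf3 B).trans_lt
      (add_lt_of_lt (aleph0_le_mk X) hB (one_lt_aleph0.trans_le (aleph0_le_mk X))))
  refine ⟨?_, fun hreg => ?_, fun hsing => ?_⟩
  · rw [← hfull ⊤ le_top fun B => Submonoid.mem_top (M := Function.End X) (f B)]
    exact mk_congr (Equiv.subtypeEquivRight fun M => by simp)
  · have hreg' : ∀ B (G : Submonoid (Function.End X)), permMonoid X ≤ G → IsPrecomplete G →
        f B ∈ G := fun B G hS hG => mem_of_isRegular hreg hS hG (hf1 B) (hf B) (hf2 B)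
    exact ⟨fun G hS hG => hfull G hS fun B => hreg' B G hS hG,
      hfull _ hSD fun B => hD _ (hreg' B)⟩
  · have hA := isPrecomplete_boundedFibreMonoid hsing
    have hSA := permMonoid_le_boundedFibreMonoid (X := X)
    have hDA : precompleteInter X ≤ boundedFibreMonoid X := sInf_le ⟨hSA, hA⟩
    refine ⟨⟨hSA, hA⟩, fun G hS hG hne => hfull G hS fun B => ?_, fun hlt => ?_, fun heq => ?_⟩
    · by_contra hB
      exact hne (eq_boundedFibreMonoid_of_not_mem hsing hS hG (hf1 B) (hf B) hB)
    · have hB : ∀ B, f B ∈ precompleteInter X := fun B =>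
        hsmall B ((mk_set_le B).trans_lt (hI.trans_lt hlt))
      exact ⟨hfull _ hSA fun B => hDA (hB B), hfull _ hSD hB⟩
    · have hle := mk_Icc_boundedFibreMonoid_le hκ hsing
      have hmono : #(Set.Icc (permMonoid X) (precompleteInter X)) ≤
          #(Set.Icc (permMonoid X) (boundedFibreMonoid X)) :=
        mk_le_mk_of_subset (Set.Icc_subset_Icc_right hDA)
      -- Since `λ = κ`, a spike map may have `κ` spikes and need not lie in `A'`, so only index sets
      -- of size less than `κ` are used.
      obtain ⟨T, b, hT, hb, hb'⟩ := exists_antichain_small (hI.trans heq)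
      have hge := two_power_le_mk_Icc hSD (fun t => f (b t)) (fun t => hsmall _ (hb t))
        (fun s => (hf _).not_bijective) fun s t h π heq => hb' s t (hf4 _ _ h π heq)
      have hge := (power_le_power_left two_ne_zero hT).trans hge
      exact ⟨hle.antisymm (hge.trans hmono), (hmono.trans hle).antisymm hge⟩
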